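/- Let $X$ be a topological space with lattice $\mathcal O(X)$ of open sets. A subset of $X$ is saturated if it is the intersection of all open sets containing it. Let $\mathsf K(X)$ be the set of all nonempty compact saturated subsets of $X$, ordered by the Smyth order: $K_1\sqsubseteq K_2$ iff $K_2\subseteq K_1$. The upper Vietoris topology on $\mathsf K(X)$ is the topology with base $\{\Box U : U\in\mathcal O(X)\}$, where $\Box U=\{K\in\mathsf K(X) : K\subseteq U\}$. Directed sets are understood to be nonempty. The Scott topology of a poset $P$ consists of the upper sets $\mathcal U\subseteq P$ that meet every directed subset $D\subseteq P$ whose supremum exists in $P$ and belongs to $\mathcal U$. The space $X$ is core compact if $(\mathcal O(X),\subseteq)$ is a continuous lattice, that is, every $U\in\mathcal O(X)$ is the union of all $V\in\mathcal O(X)$ with $V\ll U$; here $V\ll U$ means that every directed family of open sets whose union contains $U$ has a member that contains $V$. The space $X$ is well-filtered if it is $T_0$ and, for every open set $U$ and every family $\mathcal K\subseteq\mathsf K(X)$ that is directed in the Smyth order, $\bigcap\mathcal K\subseteq U$ implies $K\subseteq U$ for some $K\in\mathcal K$. Theorem. If $X$ is a core compact well-filtered space, then the upper Vietoris topology and the Scott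 topology of the Smyth order coincide on $\mathsf K(X)$. -/

import Mathlib

open Set TopologicalSpace

/-- The way-below relation `x ≪ y` of a poset: every (nonempty) directed set `D` that has a
supremum above `y` contains an element above `x`. -/
def WayBelow {L : Type*} [PartialOrder L] (x y : L) : Prop :=
  ∀ (D : Set L) (s : L), D.Nonempty → DirectedOn (· ≤ ·) D → IsLUB D s → y ≤ s → ∃ d ∈ D, x ≤ d

/-- A complete lattice is a continuous lattice if every element is the supremum of the elements
way below it. -/
def IsContinuousLattice (L : Type*) [CompleteLattice L] : Prop :=
  ∀ x : L, IsLUB {y : L | WayBelow y x} x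

/-- A space is core compact if its lattice of open sets is a continuous lattice. -/
def CoreCompact (X : Type*) [TopologicalSpace X] : Prop :=
  IsContinuousLattice (Opens X)

/-- A set is saturated if it is the intersection of all the open sets containing it. -/
def SaturatedSet {X : Type*} [TopologicalSpace X] (A : Set X) : Prop :=
  A = ⋂₀ {U : Set X | IsOpen U ∧ A ⊆ U}

/-- `KSat X` is the set of all nonempty compact saturated subsets of `X`. -/
@[ext]
structure KSat (X : Type*) [TopologicalSpace X] where
  /-- the underlying set of points -/
  carrier : Set X
  nonempty : carrier.Nonempty
  isCompact : IsCompact carrier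
  saturated : SaturatedSet carrier

/-- The Smyth order on `KSat X`, which is reverse inclusion: `K₁ ≤ K₂` means `K₂ ⊆ K₁`. -/
instance KSat.instPartialOrder (X : Type*) [TopologicalSpace X] : PartialOrder (KSat X) where
  le K₁ K₂ := K₂.carrier ⊆ K₁.carrier
  le_refl _ := Subset.rfl
  le_trans _ _ _ h₁ h₂ := h₂.trans h₁
  le_antisymm _ _ h₁ h₂ := KSat.ext (h₂.antisymm h₁)

/-- `boxSet U` is the set of all nonempty compact saturated sets contained in `U`. -/
def boxSet {X : Type*} [TopologicalSpace X] (U : Set X) : Set (KSat X) :=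
  {K : KSat X | K.carrier ⊆ U}

/-- The upper Vietoris topology on `KSat X`, generated by the sets `boxSet U` with `U` open. -/
@[reducible]
def upperVietoris (X : Type*) [TopologicalSpace X] : TopologicalSpace (KSat X) :=
  generateFrom {B : Set (KSat X) | ∃ U : Set X, IsOpen U ∧ B = boxSet U}

/-- The generating sets of the upper Vietoris topology form a base of it. -/
theorem isTopologicalBasis_upperVietoris (X : Type*) [TopologicalSpace X] :
    @IsTopologicalBasis (KSat X) (upperVietoris X)
      {B : Set (KSat X) | ∃ U : Set X, IsOpen U ∧ B = boxSet U} := by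
  let _ := upperVietoris X
  refine ⟨?_, ?_, rfl⟩
  · rintro _ ⟨U, hU, rfl⟩ _ ⟨V, hV, rfl⟩ K ⟨hKU, hKV⟩
    exact ⟨boxSet (U ∩ V), ⟨U ∩ V, hU.inter hV, rfl⟩, subset_inter hKU hKV,
      fun K' h => ⟨h.trans inter_subset_left, h.trans inter_subset_right⟩⟩
  · exact sUnion_eq_univ_iff.2 fun K => ⟨boxSet univ, ⟨univ, isOpen_univ, rfl⟩, subset_univ _⟩

/-- The Scott topology of a poset: the open sets are the upper sets `U` such that every (nonempty)
directed set whose supremum exists and lies in `U` meets `U`. -/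
@[reducible]
def scottTopology (P : Type*) [PartialOrder P] : TopologicalSpace P :=
  Topology.scott P univ

theorem isOpen_scottTopology_iff {P : Type*} [PartialOrder P] {U : Set P} :
    @IsOpen P (scottTopology P) U ↔ IsUpperSet U ∧
      ∀ (D : Set P) (s : P), D.Nonempty → DirectedOn (· ≤ ·) D → IsLUB D s → s ∈ U →
        (D ∩ U).Nonempty := by
  let _ := scottTopology P
  have : Topology.IsScott P univ := ⟨rfl⟩
  rw [Topology.IsScott.isOpen_iff_isUpperSet_and_dirSupInaccOn (D := univ)]
  refine and_congr_right fun _ => ⟨fun h D s h₁ h₂ h₃ h₄ => h (mem_univ D) h₁ h₂ h₃ h₄,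
    fun h D _ h₁ h₂ s h₃ h₄ => h D s h₁ h₂ h₃ h₄⟩

/-- A space is well-filtered if it is `T₀` and, for every open `U`, every family of nonempty compact
saturated sets that is directed in the Smyth order and has its intersection contained in `U` has a
member contained in `U`. -/
structure WellFiltered (X : Type*) [TopologicalSpace X] : Prop where
  t0 : T0Space X
  exists_subset : ∀ (U : Set X) (F : Set (KSat X)), IsOpen U → F.Nonempty →
    DirectedOn (· ≤ ·) F → (⋂ K ∈ F, K.carrier) ⊆ U → ∃ K ∈ F, K.carrier ⊆ U

/-! Well-filteredness turns directed suprema in the Smyth order into intersections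
(`WellFiltered.carrier_eq_of_isLUB`), so every box is Scott open. For the converse, each `K` is the
directed supremum of its compact saturated neighbourhoods; a Scott open set around `K` contains such
a neighbourhood `Q`, hence the whole box of the interior of `Q`.

The neighbourhoods come from local compactness (`CoreCompact.exists_kSat_between`): for `U ≪ W`,
interpolate a sequence `W = V 0 ≫ V 1 ≫ ...` above `U` and take its intersection. Its compactness
rests on `WellFiltered.exists_le_of_iInter_subset`, where Zorn's lemma and a sequence of points
produce the compact sets to which well-filteredness applies. -/

section WayBelow

variable {L : Type*}

theorem WayBelow.le [PartialOrder L] {x y : L} (h : WayBelow x y) : x ≤ y := by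
  obtain ⟨d, rfl, hd⟩ := h {y} y (singleton_nonempty y) (directedOn_singleton y)
    isLUB_singleton le_rfl
  exact hd

theorem WayBelow.of_le_of_wayBelow_of_le [PartialOrder L] {w x y z : L} (hwx : w ≤ x)
    (h : WayBelow x y) (hyz : y ≤ z) : WayBelow w z := fun D s hD hdir hs hzs =>
  let ⟨d, hd, hxd⟩ := h D s hD hdir hs (hyz.trans hzs)
  ⟨d, hd, hwx.trans hxd⟩

variable [CompleteLattice L]

theorem WayBelow.sup {x y z : L} (hx : WayBelow x z) (hy : WayBelow y z) :
    WayBelow (x ⊔ y) z := fun D s hD hdir hs hzs => by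
  obtain ⟨d, hd, hxd⟩ := hx D s hD hdir hs hzs
  obtain ⟨e, he, hye⟩ := hy D s hD hdir hs hzs
  obtain ⟨f, hf, hdf, hef⟩ := hdir d hd e he
  exact ⟨f, hf, sup_le (hxd.trans hdf) (hye.trans hef)⟩

theorem wayBelow_bot (x : L) : WayBelow ⊥ x := fun _ _ hD _ _ _ =>
  hD.imp fun _ hd => ⟨hd, bot_le⟩

theorem directedOn_setOf_wayBelow (x : L) : DirectedOn (· ≤ ·) {y : L | WayBelow y x} :=
  fun _ hy _ hz => ⟨_, WayBelow.sup hy hz, le_sup_left, le_sup_right⟩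

/-- The way-below relation of a continuous lattice has the interpolation property. -/
theorem IsContinuousLattice.exists_wayBelow_wayBelow (hL : IsContinuousLattice L) {x y : L}
    (h : WayBelow x y) : ∃ z, WayBelow x z ∧ WayBelow z y := by
  -- Continuity, used twice, makes `y` the supremum of the elements two way-below steps under it.
  obtain ⟨d, ⟨w, hdw, hwy⟩, hxd⟩ := h {z : L | ∃ w, WayBelow z w ∧ WayBelow w y} y
    ⟨⊥, ⊥, wayBelow_bot _, wayBelow_bot _⟩
    (by
      rintro a ⟨v, hav, hvy⟩ b ⟨w, hbw, hwy⟩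
      exact ⟨a ⊔ b, ⟨v ⊔ w, (hav.of_le_of_wayBelow_of_le le_rfl le_sup_left).sup
        (hbw.of_le_of_wayBelow_of_le le_rfl le_sup_right), hvy.sup hwy⟩,
        le_sup_left, le_sup_right⟩)
    ⟨fun a ⟨_, haw, hwy⟩ => haw.le.trans hwy.le,
      fun b hb => (hL y).2 fun w hwy => (hL w).2 fun a haw => hb ⟨w, haw, hwy⟩⟩ le_rfl
  exact ⟨w, hdw.of_le_of_wayBelow_of_le hxd le_rfl, hwy⟩

/-- Below `y` and above any `x ≪ y`, a continuous lattice contains a sequence descending in the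
way-below relation. -/
theorem IsContinuousLattice.exists_seq_wayBelow (hL : IsContinuousLattice L) {x y : L}
    (h : WayBelow x y) :
    ∃ v : ℕ → L, v 0 = y ∧ (∀ n, WayBelow (v (n + 1)) (v n)) ∧ ∀ n, x ≤ v n := by
  choose! g hg using fun z (hz : WayBelow x z) => hL.exists_wayBelow_wayBelow hz
  have key (n : ℕ) : WayBelow x (g^[n] y) := by
    induction n with
    | zero => exact h
    | succ n ih => rw [Function.iterate_succ_apply']; exact (hg _ ih).1
  refine ⟨fun n => g^[n] y, rfl, fun n => ?_, fun n => (key n).le⟩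
  simp only [Function.iterate_succ_apply']
  exact (hg _ (key n)).2

end WayBelow

section Saturated

variable {X : Type*} [TopologicalSpace X]

theorem saturatedSet_iff {A : Set X} :
    SaturatedSet A ↔ ∀ x, (∀ U : Set X, IsOpen U → A ⊆ U → x ∈ U) → x ∈ A := by
  refine ⟨fun h x hx => ?_, fun h => Subset.antisymm (fun x hx U hU => hU.2 hx)
    fun x hx => h x fun U hU hAU => hx U ⟨hU, hAU⟩⟩
  rw [h]
  exact fun U hU => hx U hU.1 hU.2

theorem IsOpen.saturatedSet {U : Set X} (hU : IsOpen U) : SaturatedSet U :=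
  saturatedSet_iff.2 fun _ hx => hx U hU Subset.rfl

theorem SaturatedSet.iInter {ι : Sort*} {A : ι → Set X} (h : ∀ i, SaturatedSet (A i)) :
    SaturatedSet (⋂ i, A i) :=
  saturatedSet_iff.2 fun x hx => mem_iInter.2 fun i => saturatedSet_iff.1 (h i) x
    fun U hU hA => hx U hU ((iInter_subset A i).trans hA)

/-- The saturation of a nonempty compact set. -/
def IsCompact.saturation {B : Set X} (hB : IsCompact B) (hne : B.Nonempty) : KSat X where
  carrier := ⋂₀ {U : Set X | IsOpen U ∧ B ⊆ U}
  nonempty := hne.mono fun _ hx _ hU => hU.2 hx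
  isCompact := by
    rw [isCompact_iff_finite_subcover]
    intro ι U hU hcover
    obtain ⟨t, ht⟩ := hB.elim_finite_subcover U hU
      ((subset_sInter fun _ hV => hV.2).trans hcover)
    exact ⟨t, fun x hx => hx _ ⟨isOpen_biUnion fun i _ => hU i, ht⟩⟩
  saturated := saturatedSet_iff.2 fun x hx V hV => hx V hV.1 fun _ hy => hy V hV

theorem IsCompact.subset_saturation {B : Set X} (hB : IsCompact B) (hne : B.Nonempty) :
    B ⊆ (hB.saturation hne).carrier :=
  fun _ hx _ hU => hU.2 hx

theorem IsCompact.saturation_subset_iff {B U : Set X} (hB : IsCompact B) (hne : B.Nonempty)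
    (hU : IsOpen U) : (hB.saturation hne).carrier ⊆ U ↔ B ⊆ U :=
  ⟨(hB.subset_saturation hne).trans, fun h _ hx => hx U ⟨hU, h⟩⟩

end Saturated

section WellFiltered

variable {X : Type*} [TopologicalSpace X]

theorem WayBelow.exists_le_of_le_sSup {V W : Opens X} (h : WayBelow V W) {D : Set (Opens X)}
    (hne : D.Nonempty) (hdir : DirectedOn (· ≤ ·) D) (hW : W ≤ sSup D) : ∃ d ∈ D, V ≤ d :=
  h D _ hne hdir (isLUB_sSup D) hW

/-- In the lattice of open sets, an open set containing no member of a sequence descending in the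
way-below relation extends to a maximal one. -/
theorem exists_maximal_not_le_of_wayBelow {V : ℕ → Opens X}
    (hV : ∀ n, WayBelow (V (n + 1)) (V n)) {U : Opens X} (hU : ∀ n, ¬ V n ≤ U) :
    ∃ M, U ≤ M ∧ Maximal (fun W => ∀ n, ¬ V n ≤ W) M := by
  refine zorn_le_nonempty₀ {W : Opens X | ∀ n, ¬ V n ≤ W} (fun c hc hchain W hW => ?_) U hU
  refine ⟨sSup c, fun n hn => ?_, fun W hW => le_sSup hW⟩
  -- If the union of the chain contains `V n`, one member already contains `V (n + 1)`.
  obtain ⟨d, hd, hle⟩ := (hV n).exists_le_of_le_sSup ⟨W, hW⟩ hchain.directedOn hn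
  exact hc hd _ hle

/-- In a well-filtered space, an open set that contains the intersection of a sequence of open sets
descending in the way-below relation contains a member of the sequence. -/
theorem WellFiltered.exists_le_of_iInter_subset (hwf : WellFiltered X) {V : ℕ → Opens X}
    (hV : ∀ n, WayBelow (V (n + 1)) (V n)) {U : Opens X} (hU : ⋂ n, (V n : Set X) ⊆ U) :
    ∃ n, V n ≤ U := by
  by_contra! hcon
  have hanti : Antitone V := antitone_nat_of_succ_le fun n => (hV n).le
  obtain ⟨M, hUM, hM⟩ := exists_maximal_not_le_of_wayBelow hV hcon
  choose x hxV hxM using fun n => SetLike.not_le_iff_exists.1 (hM.prop n)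
  -- By maximality of `M`, an open set outside of `M` contains all but finitely many `x n`.
  have hfin {W : Set X} (hW : IsOpen W) {n : ℕ} (hn : x n ∈ W) :
      ∃ N, ∀ m, N ≤ m → x m ∈ W := by
    -- If infinitely many `x m` miss `W`, the complement of their closure strictly enlarges `M`, as
    -- it contains `x n`, yet it still contains no `V k`.
    by_contra! hinf
    let C : Set X := closure (x '' {m | x m ∉ W})
    have hCW : C ⊆ Wᶜ := closure_minimal (by rintro _ ⟨m, hm, rfl⟩; exact hm) hW.isClosed_compl
    have hCM : C ⊆ (M : Set X)ᶜ :=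
      closure_minimal (by rintro _ ⟨m, -, rfl⟩; exact hxM m) M.isOpen.isClosed_compl
    let M' : Opens X := ⟨Cᶜ, isClosed_closure.isOpen_compl⟩
    have hMM' : M ≤ M' := fun y hy hyC => hCM hyC hy
    have hM' : ∀ k, ¬ V k ≤ M' := fun k hk => by
      obtain ⟨m, hkm, hm⟩ := hinf k
      exact hk (hanti hkm (hxV m)) (subset_closure ⟨m, hm, rfl⟩)
    exact hxM n (hM.le_of_ge hM' hMM' fun hC => hCW hC hn)
  -- Any cover member meeting the tail catches all but finitely many of its points.
  have hcomp (n : ℕ) : IsCompact (x '' Ici n) := by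
    rw [isCompact_iff_finite_subcover]
    intro ι W hW hcover
    obtain ⟨i, hi⟩ := mem_iUnion.1 (hcover ⟨n, self_mem_Ici, rfl⟩)
    obtain ⟨N, hN⟩ := hfin (hW i) hi
    obtain ⟨t, ht⟩ := ((finite_Ico n N).image x).isCompact.elim_finite_subcover W hW
      ((image_mono Ico_subset_Ici_self).trans hcover)
    classical
    refine ⟨insert i t, ?_⟩
    rintro _ ⟨m, hm, rfl⟩
    rw [Finset.set_biUnion_insert]
    rcases lt_or_ge m N with hmN | hmN
    · exact Or.inr (ht ⟨m, ⟨hm, hmN⟩, rfl⟩)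
    · exact Or.inl (hN m hmN)
  have hne (n : ℕ) : (x '' Ici n).Nonempty := ⟨x n, n, self_mem_Ici, rfl⟩
  let K (n : ℕ) : KSat X := (hcomp n).saturation (hne n)
  have hKV (n : ℕ) : (K n).carrier ⊆ V n :=
    ((hcomp n).saturation_subset_iff (hne n) (V n).isOpen).2
      (by rintro _ ⟨m, hm, rfl⟩; exact hanti hm (hxV m))
  have hKmono : Monotone K := fun m n hmn _ hy W hW =>
    hy W ⟨hW.1, (image_mono (Ici_subset_Ici.2 hmn)).trans hW.2⟩
  obtain ⟨_, ⟨n, rfl⟩, hn⟩ := hwf.exists_subset U (range K) U.isOpen (range_nonempty K)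
    (directedOn_range.2 hKmono.directed_le)
    (by rw [biInter_range]; exact (iInter_mono hKV).trans hU)
  exact hxM n (hUM (hn ((hcomp n).subset_saturation (hne n) ⟨n, self_mem_Ici, rfl⟩)))

/-- An open cover of the intersection already covers some `V n`; since `V (n + 1) ≪ V n`, finitely
many members cover `V (n + 1)`. -/
theorem WellFiltered.isCompact_iInter (hwf : WellFiltered X) {V : ℕ → Opens X}
    (hV : ∀ n, WayBelow (V (n + 1)) (V n)) : IsCompact (⋂ n, (V n : Set X)) := by
  rw [isCompact_iff_finite_subcover]
  intro ι W hW hcover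
  let S (t : Finset ι) : Opens X := ⟨⋃ i ∈ t, W i, isOpen_biUnion fun i _ => hW i⟩
  have hS : Monotone S := fun s t hst => biUnion_subset_biUnion_left hst
  obtain ⟨n, hn⟩ := hwf.exists_le_of_iInter_subset hV (U := ⟨⋃ i, W i, isOpen_iUnion hW⟩) hcover
  obtain ⟨_, ⟨t, rfl⟩, ht⟩ := (hV n).exists_le_of_le_sSup (range_nonempty S)
    (directedOn_range.2 hS.directed_le) (hn.trans fun y hy => by
      obtain ⟨i, hi⟩ := mem_iUnion.1 hy
      have hiS : y ∈ S {i} := mem_biUnion (Finset.mem_coe.2 (Finset.mem_singleton_self i)) hi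
      exact (le_sSup (mem_range_self {i}) : S {i} ≤ _) hiS)
  exact ⟨t, (iInter_subset _ (n + 1)).trans ht⟩

/-- A compact subset of an open set of a core compact space lies in an open set way below it. -/
theorem CoreCompact.exists_wayBelow_of_isCompact (hcc : CoreCompact X) {K : Set X}
    (hK : IsCompact K) {W : Opens X} (hKW : K ⊆ W) :
    ∃ V : Opens X, K ⊆ V ∧ WayBelow V W := by
  have hdir : Directed (· ⊆ ·) fun V : {V : Opens X | WayBelow V W} => (V.1 : Set X) :=
    directedOn_iff_directed.1 (directedOn_setOf_wayBelow W)
  have : Nonempty {V : Opens X | WayBelow V W} := ⟨⟨⊥, wayBelow_bot W⟩⟩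
  obtain ⟨⟨V, hV⟩, hKV⟩ := hK.elim_directed_cover _ (fun V => V.1.isOpen) (fun y hy => by
    have hy' := hKW hy
    rw [← (hcc W).sSup_eq] at hy'
    obtain ⟨V, hV, hyV⟩ := Opens.mem_sSup.1 hy'
    exact mem_iUnion.2 ⟨⟨V, hV⟩, hyV⟩) hdir
  exact ⟨V, hKV, hV⟩

/-- A core compact well-filtered space is locally compact: nonempty compact subsets of open sets
have compact saturated neighbourhoods inside them. -/
theorem CoreCompact.exists_kSat_between (hcc : CoreCompact X) (hwf : WellFiltered X) {K : Set X}
    (hK : IsCompact K) (hne : K.Nonempty) {W : Set X} (hW : IsOpen W) (hKW : K ⊆ W) :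
    ∃ Q : KSat X, K ⊆ interior Q.carrier ∧ Q.carrier ⊆ W := by
  obtain ⟨U, hKU, hUW⟩ := hcc.exists_wayBelow_of_isCompact hK (W := ⟨W, hW⟩) hKW
  obtain ⟨V, hV0, hV, hUV⟩ := IsContinuousLattice.exists_seq_wayBelow hcc hUW
  have hUQ : (U : Set X) ⊆ ⋂ n, (V n : Set X) := subset_iInter hUV
  refine ⟨⟨⋂ n, (V n : Set X), hne.mono (hKU.trans hUQ), hwf.isCompact_iInter hV,
    SaturatedSet.iInter fun n => (V n).isOpen.saturatedSet⟩,
    hKU.trans (interior_maximal hUQ U.isOpen), (iInter_subset _ 0).trans ?_⟩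
  rw [hV0]
  exact Subset.rfl

/-- In a well-filtered space, suprema of directed sets in the Smyth order are intersections. -/
theorem WellFiltered.carrier_eq_of_isLUB (hwf : WellFiltered X) {D : Set (KSat X)} {s : KSat X}
    (hne : D.Nonempty) (hdir : DirectedOn (· ≤ ·) D) (hs : IsLUB D s) :
    s.carrier = ⋂ K ∈ D, K.carrier := by
  refine Subset.antisymm (subset_iInter₂ fun K hK => hs.1 hK) ?_
  have hnonempty : (⋂ K ∈ D, K.carrier).Nonempty := by
    by_contra hempty
    obtain ⟨K, -, hK⟩ := hwf.exists_subset ∅ D isOpen_empty hne hdir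
      (not_nonempty_iff_eq_empty.1 hempty).subset
    exact (K.nonempty.mono hK).ne_empty rfl
  have hcompact : IsCompact (⋂ K ∈ D, K.carrier) := by
    rw [isCompact_iff_finite_subcover]
    intro ι W hW hcover
    obtain ⟨K, hK, hKW⟩ := hwf.exists_subset _ D (isOpen_iUnion hW) hne hdir hcover
    obtain ⟨t, ht⟩ := K.isCompact.elim_finite_subcover W hW hKW
    exact ⟨t, (biInter_subset_of_mem hK).trans ht⟩
  let Q : KSat X := ⟨_, hnonempty, hcompact,
    SaturatedSet.iInter fun K => SaturatedSet.iInter fun _ => K.saturated⟩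
  -- The intersection is itself an upper bound in `KSat X`, so the least upper bound contains it as
  -- a set.
  exact hs.2 (show Q ∈ upperBounds D from fun K hK => biInter_subset_of_mem hK)

/-- In a well-filtered space, the Scott topology of the Smyth order refines the upper Vietoris
topology. -/
theorem WellFiltered.isOpen_scottTopology_boxSet (hwf : WellFiltered X) {U : Set X}
    (hU : IsOpen U) : @IsOpen _ (scottTopology (KSat X)) (boxSet U) := by
  refine isOpen_scottTopology_iff.2 ⟨fun K Q (hKQ : Q.carrier ⊆ K.carrier) hK => hKQ.trans hK,
    fun D s hne hdir hs hsU => ?_⟩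
  exact hwf.exists_subset U D hU hne hdir
    ((hwf.carrier_eq_of_isLUB hne hdir hs).symm.subset.trans hsU)

/-- In a core compact well-filtered space, a compact saturated set is the directed supremum of its
compact saturated neighbourhoods in the Smyth order. -/
theorem CoreCompact.isLUB_setOf_subset_interior (hcc : CoreCompact X) (hwf : WellFiltered X)
    (K : KSat X) :
    {Q : KSat X | K.carrier ⊆ interior Q.carrier}.Nonempty ∧
      DirectedOn (· ≤ ·) {Q : KSat X | K.carrier ⊆ interior Q.carrier} ∧
      IsLUB {Q : KSat X | K.carrier ⊆ interior Q.carrier} K := by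
  refine ⟨?_, fun Q₁ h₁ Q₂ h₂ => ?_, fun Q hQ => Subset.trans (mem_ofPred.1 hQ) interior_subset,
    fun Q hQ => ?_⟩
  · obtain ⟨Q, hQ, -⟩ := hcc.exists_kSat_between hwf K.isCompact K.nonempty isOpen_univ
      (subset_univ _)
    exact ⟨Q, hQ⟩
  · obtain ⟨Q, hQ, hQs⟩ := hcc.exists_kSat_between hwf K.isCompact K.nonempty
      (isOpen_interior.inter isOpen_interior) (subset_inter h₁ h₂)
    exact ⟨Q, hQ, (hQs.trans inter_subset_left).trans interior_subset,
      (hQs.trans inter_subset_right).trans interior_subset⟩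
  · refine fun x hx => saturatedSet_iff.1 K.saturated x fun U hU hKU => ?_
    obtain ⟨Q', hQ', hQU⟩ := hcc.exists_kSat_between hwf K.isCompact K.nonempty hU hKU
    exact hQU (hQ hQ' hx)

end WellFiltered

theorem mainTheorem1 (X : Type*) [TopologicalSpace X] (hcc : CoreCompact X)
    (hwf : WellFiltered X) : upperVietoris X = scottTopology (KSat X) := by
  let _ := upperVietoris X
  refine le_antisymm (fun 𝒰 h𝒰 => ?_) (le_generateFrom ?_)
  · obtain ⟨hupper, hinacc⟩ := isOpen_scottTopology_iff.1 h𝒰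
    refine (isTopologicalBasis_upperVietoris X).isOpen_iff.2 fun K hK => ?_
    obtain ⟨hne, hdir, hlub⟩ := hcc.isLUB_setOf_subset_interior hwf K
    obtain ⟨Q, hKQ, hQ⟩ := hinacc _ K hne hdir hlub hK
    exact ⟨boxSet (interior Q.carrier), ⟨_, isOpen_interior, rfl⟩, hKQ,
      fun K' (hK' : K'.carrier ⊆ interior Q.carrier) =>
        hupper (show Q ≤ K' from hK'.trans interior_subset) hQ⟩
  · rintro _ ⟨U, hU, rfl⟩
    exact hwf.isOpen_scottTopology_boxSet hU
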